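/- Let $\vec G=(V,E)$ be a connected directed graph without self-loops (a tree or not; "connected" and "tree" refer to the underlying undirected graph), with $V=\{1,\dots,n\}$ and $E=\{e_1,\dots,e_m\}$, where $e_i$ is directed from $e_i^-$ to $e_i^+$ (parallel edges are allowed). Let $D\in\{-1,0,1\}^{m\times n}$ be its incidence matrix: $D_{i,e_i^-}=-1$, $D_{i,e_i^+}=1$, and all other entries of row $i$ are $0$. For $S\subseteq\{1,\dots,m\}$ let $D_{-S}$ be the matrix of the rows of $D$ with index not in $S$, and let $E_S=\{e_i: i\in S\}$. Fix a root vertex $r\in V$. Let $\bar S_1,\dots,\bar S_p$ be all the distinct sets $\bar S\subseteq\{1,\dots,m\}$ such that $|\bar S|=m-n+2$, $\operatorname{rank}(D_{-\bar S})=n-2$, and $(V,E\setminus E_{\bar S})$ is the disjoint union of two trees with vertex sets $V_1\ni r$ and $V_2$, where $V_1\cap V_2=\emptyset$ and $V_1\cup V_2=V$. Write $(V_1)_j,(V_2)_j$ for the vertex sets belonging to $\bar S_j$; they are determined by $\bar S_j$. Let $v_j\in\{0,1\}^n$ be the indicator vector of $(V_2)_j$, let $X_j=v_j/\|Dv_j\|_1$,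 and let $X=[X_1\ \cdots\ X_p]\in\mathbb R^{n\times p}$. Let $Y\in\mathbb R^n$ and $\lambda>0$, and write $\|v\|_n^2=\|v\|_2^2/n$. Then the analysis problem $$\min_{f\in\mathbb R^n}\left\{\|Y-f\|_n^2+2\lambda\|Df\|_1\right\}$$ has exactly one solution $\hat f_A$; the lasso problem $$\min_{\beta\in\mathbb R^{p+1}}\left\{\|Y-[1_n\ X]\beta\|_n^2+2\lambda\|\beta_{-1}\|_1\right\},$$ in which the coefficient $\beta_1$ of the column $1_n$ of ones is not penalized, has a solution; and every solution $\hat\beta$ of it satisfies $$\hat f_A=[1_n\ X]\,\hat\beta .$$ The same holds if repeated atoms are removed, that is, if $X$ has one column for each distinct set $(V_2)_j$ instead of one for each set $\bar S_j$. -/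

import Mathlib

/-- A directed graph with vertex set `Fin n` and edges `e_0, …, e_{m-1}`; the edge `e_i` goes from
the vertex `src i` to the vertex `tgt i`. There are no self-loops (the incidence matrix is not
defined for them); parallel and antiparallel edges are allowed. -/
structure DirGraph (n m : ℕ) where
  src : Fin m → Fin n
  tgt : Fin m → Fin n
  loopless : ∀ i, src i ≠ tgt i

namespace DirGraph

variable {n m : ℕ}

/-- The incidence matrix `D` of the graph: one row per edge, one column per vertex. -/
def incidence (G : DirGraph n m) : Matrix (Fin m) (Fin n) ℝ :=
  Matrix.of fun i j => if j = G.src i then -1 else if j = G.tgt i then 1 else 0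

/-- The undirected graph on all vertices that underlies `(V, E \ E_S)`: the edges with index in `S`
are deleted, orientations are forgotten. -/
def deleteEdges (G : DirGraph n m) (S : Finset (Fin m)) : SimpleGraph (Fin n) where
  Adj u v := ∃ i, i ∉ S ∧ ((G.src i = u ∧ G.tgt i = v) ∨ (G.src i = v ∧ G.tgt i = u))
  symm := ⟨by
    rintro u v ⟨i, hi, h⟩
    exact ⟨i, hi, h.symm⟩⟩
  loopless := ⟨by
    rintro u ⟨i, _, h | h⟩
    · exact G.loopless i (h.1.trans h.2.symm)
    · exact G.loopless i (h.1.trans h.2.symm)⟩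

/-- The graph is connected (as an undirected graph). -/
def Connected (G : DirGraph n m) : Prop := (G.deleteEdges ∅).Connected

/-- `D_{-S}`: the rows of the incidence matrix whose index is not in `S`. -/
def incidenceCompl (G : DirGraph n m) (S : Finset (Fin m)) :
    Matrix {i : Fin m // i ∉ S} (Fin n) ℝ :=
  G.incidence.submatrix Subtype.val id

/-- `S` is a set of `m - n + 2` edge indices, `D_{-S}` has rank `n - 2`, and `(V, E \ E_S)` is the
disjoint union of two trees with vertex sets `V₁` and `V₂`, where `V₁` contains the root `r`.
(The two numerical conditions are written without subtraction.) -/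
structure IsTwoTreeCut (G : DirGraph n m) (r : Fin n) (S : Finset (Fin m))
    (V₁ V₂ : Finset (Fin n)) : Prop where
  card_eq : S.card + n = m + 2
  rank_eq : (G.incidenceCompl S).rank + 2 = n
  inter_eq : V₁ ∩ V₂ = ∅
  union_eq : V₁ ∪ V₂ = Finset.univ
  root_mem : r ∈ V₁
  no_cross : ∀ u ∈ V₁, ∀ v ∈ V₂, ¬ (G.deleteEdges S).Adj u v
  tree₁ : ((G.deleteEdges S).induce (V₁ : Set (Fin n))).IsTree
  tree₂ : ((G.deleteEdges S).induce (V₂ : Set (Fin n))).IsTree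

/-- The index set of the dictionary: all edge sets `S` as above. -/
def CutIndex (G : DirGraph n m) (r : Fin n) : Type :=
  {S : Finset (Fin m) // ∃ V₁ V₂, G.IsTwoTreeCut r S V₁ V₂}

/-- The index set of the dictionary without repeated atoms: all vertex sets `V₂` that arise from
an edge set `S` as above. -/
def SideIndex (G : DirGraph n m) (r : Fin n) : Type :=
  {V₂ : Finset (Fin n) // ∃ S V₁, G.IsTwoTreeCut r S V₁ V₂}

noncomputable instance (G : DirGraph n m) (r : Fin n) : Fintype (G.CutIndex r) :=
  @Fintype.ofFinite _ (inferInstanceAs (Finite {S : Finset (Fin m) // _}))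

noncomputable instance (G : DirGraph n m) (r : Fin n) : Fintype (G.SideIndex r) :=
  @Fintype.ofFinite _ (inferInstanceAs (Finite {V₂ : Finset (Fin n) // _}))

open Classical in
/-- The vertices that are not joined to the root `r` in `(V, E \ E_S)`. -/
noncomputable def farSide (G : DirGraph n m) (r : Fin n) (S : Finset (Fin m)) :
    Finset (Fin n) :=
  Finset.univ.filter fun i => ¬ (G.deleteEdges S).Reachable r i

/-- The set `V₂` is determined by `S`: it is `farSide r S`. -/
theorem IsTwoTreeCut.eq_farSide {G : DirGraph n m} {r : Fin n} {S : Finset (Fin m)}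
    {V₁ V₂ : Finset (Fin n)} (h : G.IsTwoTreeCut r S V₁ V₂) : V₂ = G.farSide r S := by
  have key : ∀ i, (G.deleteEdges S).Reachable r i → i ∈ V₁ := by
    rintro i ⟨w⟩
    have hw : ∀ {a b : Fin n}, (G.deleteEdges S).Walk a b → a ∈ V₁ → b ∈ V₁ := by
      intro a b w
      induction w with
      | nil => exact id
      | @cons x y z hxy _ ih =>
        intro hx
        apply ih
        by_contra hy
        have hu : y ∈ V₁ ∪ V₂ := h.union_eq ▸ Finset.mem_univ y
        rcases Finset.mem_union.1 hu with hu | hu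
        · exact hy hu
        · exact h.no_cross x hx y hu hxy
    exact hw w h.root_mem
  ext i
  simp only [farSide, Finset.mem_filter, Finset.mem_univ, true_and]
  constructor
  · intro hi hr
    have : i ∈ V₁ ∩ V₂ := Finset.mem_inter.2 ⟨key i hr, hi⟩
    rw [h.inter_eq] at this
    simp at this
  · intro hi
    have hu : i ∈ V₁ ∪ V₂ := h.union_eq ▸ Finset.mem_univ i
    rcases Finset.mem_union.1 hu with hu | hu
    · exfalso
      apply hi
      have := h.tree₁.connected.preconnected ⟨r, h.root_mem⟩ ⟨i, hu⟩
      exact this.map (SimpleGraph.Embedding.induce _).toHom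
    · exact hu

end DirGraph

/-- The `ℓ¹` norm of a real vector with finite index set. -/
def l1norm {ι : Type} [Fintype ι] (v : ι → ℝ) : ℝ := ∑ i, |v i|

/-- `‖v‖_n ^ 2 = ‖v‖_2 ^ 2 / n`. -/
noncomputable def sqNorm {n : ℕ} (v : Fin n → ℝ) : ℝ := (∑ i, v i ^ 2) / n

/-- The set of all global minimizers of `F`. -/
def argmin {α : Type} (F : α → ℝ) : Set α := {x | ∀ y, F x ≤ F y}

/-- The set of minimizers in the analysis problem with analysing operator `D`. -/
noncomputable def analysisArgmin {n m : ℕ} (D : Matrix (Fin m) (Fin n) ℝ) (Y : Fin n → ℝ)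
    (lam : ℝ) : Set (Fin n → ℝ) :=
  argmin fun f => sqNorm (Y - f) + 2 * lam * l1norm (D.mulVec f)

/-- The matrix `[1_n X]`. -/
def onesCols {n : ℕ} {ι : Type} (X : Matrix (Fin n) ι ℝ) : Matrix (Fin n) (Unit ⊕ ι) ℝ :=
  Matrix.fromCols (Matrix.of fun _ _ => 1) X

/-- The set of solutions of the lasso problem with design matrix `[1_n X]` in which the coefficient
of the column `1_n` is not penalized. -/
noncomputable def lassoArgmin {n : ℕ} {ι : Type} [Fintype ι] (X : Matrix (Fin n) ι ℝ)
    (Y : Fin n → ℝ) (lam : ℝ) : Set (Unit ⊕ ι → ℝ) :=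
  argmin fun β => sqNorm (Y - (onesCols X).mulVec β) + 2 * lam * l1norm fun j => β (Sum.inr j)

namespace DirGraph

variable {n m : ℕ}

/-- The indicator vector of a set of vertices. -/
def indicatorVec (W : Finset (Fin n)) : Fin n → ℝ := fun i => if i ∈ W then 1 else 0

/-- The atom `v / ‖D v‖₁`, where `v` is the indicator vector of `W`. -/
noncomputable def atom (G : DirGraph n m) (W : Finset (Fin n)) : Fin n → ℝ :=
  fun i => indicatorVec W i / l1norm (G.incidence.mulVec (indicatorVec W))

/-- The dictionary with one column for each admissible edge set. -/
noncomputable def cutDictionary (G : DirGraph n m) (r : Fin n) :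
    Matrix (Fin n) (G.CutIndex r) ℝ :=
  Matrix.of fun i S => G.atom (G.farSide r S.1) i

/-- The dictionary with one column for each partition of the vertices that arises from an admissible
edge set. -/
noncomputable def sideDictionary (G : DirGraph n m) (r : Fin n) :
    Matrix (Fin n) (G.SideIndex r) ℝ :=
  Matrix.of fun i W => G.atom W.1 i

end DirGraph

/-! The penalty `‖D f‖₁` is the least `ℓ¹` norm of penalized coefficients representing `f`, so
profiling the lasso over all representations of a fit gives the analysis problem
(`image_lassoArgmin_eq_analysisArgmin`). One inequality is the triangle inequality, as `‖D X_j‖₁ ≤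
1`.

The other (`exists_coefficients`) peels atoms off `f`. A non-constant `f` is strictly monotone
across some cut with two connected sides (`exists_connected_cut_lt`). Subtracting the smallest jump
across it times the indicator of a side shrinks every jump on the cut without changing its sign, so
`‖D f‖₁` falls by exactly the coefficient of the atom, and one more edge becomes flat. Spanning
trees of the two sides show that the cut belongs to the dictionary (`exists_isTwoTreeCut`). -/

/-! ### Cuts with two connected sides -/

namespace SimpleGraph

variable {V : Type*}

/-- If `H' ≤ H`, then `H` is connected on every connected component of `H'`. -/
theorem induce_connected_of_reachable_le {H H' : SimpleGraph V} (hle : H' ≤ H) (y : V) :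
    (H.induce {v | H'.Reachable y v}).Connected := by
  have hs : {v | H'.Reachable y v} = (H'.connectedComponentMk y).supp := by
    ext v
    simp only [Set.mem_ofPred_eq, ConnectedComponent.mem_supp_iff, ConnectedComponent.eq]
    exact ⟨fun h => h.symm, fun h => h.symm⟩
  rw [hs]
  exact (H'.connectedComponentMk y).connected_toSimpleGraph.mono fun _ _ h => hle h

/-- A non-constant function on the vertices of a finite connected graph increases strictly across
some cut both of whose sides are connected. -/
theorem Connected.exists_connected_cut_lt [Finite V] {H : SimpleGraph V} (hH : H.Connected)
    {f : V → ℝ} (hf : ∃ u v, f u ≠ f v) :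
    ∃ K : Set V, (H.induce K).Connected ∧ (H.induce Kᶜ).Connected ∧
      ∀ u ∈ K, ∀ v ∉ K, H.Adj u v → f u < f v := by
  have := hH.nonempty
  obtain ⟨x, hx⟩ := Finite.exists_max f
  -- The component `C` of `x` in `H₁` is a connected piece of the set where `f` is maximal; `f`
  -- drops along every edge leaving it.
  let H₁ : SimpleGraph V := SimpleGraph.mk (fun u v => H.Adj u v ∧ f u = f x ∧ f v = f x)
    ⟨fun u v h => ⟨h.1.symm, h.2.2, h.2.1⟩⟩ ⟨fun u h => H.loopless.irrefl u h.1⟩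
  have hC : ∀ v, H₁.Reachable x v → f v = f x := by
    rintro v ⟨w⟩
    cases w.reverse with
    | nil => rfl
    | cons h _ => exact h.2.1
  have hbd : ∀ u v, H₁.Reachable x u → ¬ H₁.Reachable x v → H.Adj u v → f v < f u := by
    intro u v hu hv huv
    rw [hC u hu]
    refine lt_of_le_of_ne (hx v) fun h => hv (hu.trans (Adj.reachable ?_))
    exact ⟨huv, hC u hu, h⟩
  obtain ⟨y, hy⟩ : ∃ y, ¬ H₁.Reachable x y := by
    by_contra! h
    obtain ⟨u, v, huv⟩ := hf
    exact huv ((hC u (h u)).trans (hC v (h v)).symm)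
  -- `H₂` is `H` off `C`. The cut set is the component of `y` in it, so all edges leaving it end in
  -- `C`.
  let H₂ : SimpleGraph V := SimpleGraph.mk
    (fun u v => H.Adj u v ∧ ¬ H₁.Reachable x u ∧ ¬ H₁.Reachable x v)
    ⟨fun u v h => ⟨h.1.symm, h.2.2, h.2.1⟩⟩ ⟨fun u h => H.loopless.irrefl u h.1⟩
  have hK : ∀ v, H₂.Reachable y v → ¬ H₁.Reachable x v := by
    rintro v ⟨w⟩
    cases w.reverse with
    | nil => exact hy
    | cons h _ => exact h.2.1
  have hcross : ∀ u v, H₂.Reachable y u → ¬ H₂.Reachable y v → H.Adj u v →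
      H₁.Reachable x v := by
    intro u v hu hv huv
    by_contra h
    refine hv (hu.trans (Adj.reachable ?_))
    exact ⟨huv, hK u hu, h⟩
  have hxK : x ∈ {v | H₂.Reachable y v}ᶜ := fun h => hK x h (Reachable.refl x)
  have hsub : {v | H₁.Reachable x v} ≤ {v | H₂.Reachable y v}ᶜ := fun v hv h => hK v h hv
  have hCK : ∀ v (hv : H₁.Reachable x v),
      (H.induce {v | H₂.Reachable y v}ᶜ).Reachable ⟨v, hsub hv⟩ ⟨x, hxK⟩ := by
    intro v hv
    have h := (induce_connected_of_reachable_le (H := H) (H' := H₁) (fun _ _ h => h.1) x).preconnected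
      ⟨v, hv⟩ ⟨x, Reachable.refl x⟩
    exact h.map (induceHomOfLE H hsub).toHom
  have hle : H₂ ≤ H := fun _ _ h => h.1
  refine ⟨{v | H₂.Reachable y v}, induce_connected_of_reachable_le hle y, ?_, ?_⟩
  -- Follow a walk to `x`: just before it would enter the cut set it is in `C`, from where `x` is
  -- reachable inside `C`.
  · have key : ∀ {a b : V} (_ : H.Walk a b), b = x → ∀ ha : a ∈ {v | H₂.Reachable y v}ᶜ,
        (H.induce {v | H₂.Reachable y v}ᶜ).Reachable ⟨a, ha⟩ ⟨x, hxK⟩ := by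
      intro a b w
      induction w with
      | nil => rintro rfl ha; exact Reachable.refl _
      | @cons a c b hac _ ih =>
        intro hb ha
        by_cases hc : H₂.Reachable y c
        · exact hCK a (hcross c a hc ha hac.symm)
        · refine Reachable.trans (Adj.reachable ?_) (ih hb hc)
          exact hac
    have hr : ∀ a : ({v | H₂.Reachable y v}ᶜ : Set V),
        (H.induce {v | H₂.Reachable y v}ᶜ).Reachable a ⟨x, hxK⟩ := by
      rintro ⟨a, ha⟩
      obtain ⟨w⟩ := hH.preconnected a x
      exact key w rfl ha
    exact { preconnected := fun a b => (hr a).trans (hr b).symm, nonempty := ⟨⟨x, hxK⟩⟩ }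
  · intro u hu v hv huv
    exact hbd v u (hcross u v hu hv huv) (hK u hu) huv.symm

end SimpleGraph

/-! ### Incidence matrix, spanning trees and admissible edge sets -/

namespace DirGraph

variable {n m : ℕ}

theorem incidence_mulVec (G : DirGraph n m) (f : Fin n → ℝ) (i : Fin m) :
    G.incidence.mulVec f i = f (G.tgt i) - f (G.src i) := by
  have h : ∀ j, G.incidence i j * f j =
      (if j = G.tgt i then f j else 0) - (if j = G.src i then f j else 0) := by
    intro j
    have := G.loopless i
    simp only [incidence, Matrix.of_apply]
    split_ifs with h1 h2 h2
    · exact absurd (h1.symm.trans h2) this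
    all_goals ring
  simp [Matrix.mulVec, dotProduct, h, Finset.sum_sub_distrib]

theorem deleteEdges_adj_endpoints (G : DirGraph n m) {S : Finset (Fin m)} {i : Fin m} (hi : i ∉ S) :
    (G.deleteEdges S).Adj (G.src i) (G.tgt i) :=
  ⟨i, hi, Or.inl ⟨rfl, rfl⟩⟩

theorem eq_of_reachable (G : DirGraph n m) {S : Finset (Fin m)} {f : Fin n → ℝ}
    (hf : ∀ i ∉ S, f (G.tgt i) = f (G.src i)) {u v : Fin n} (h : (G.deleteEdges S).Reachable u v) :
    f u = f v := by
  obtain ⟨w⟩ := h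
  induction w with
  | nil => rfl
  | cons h _ ih =>
    rw [← ih]
    obtain ⟨i, hi, ⟨rfl, rfl⟩ | ⟨rfl, rfl⟩⟩ := h
    · exact (hf i hi).symm
    · exact hf i hi

/-- If the graph without the edges in `S` is covered by two connected sets, then `D_{-S}` has rank
at least `n - 2`. -/
theorem le_rank_incidenceCompl (G : DirGraph n m) {S : Finset (Fin m)} {a b : Fin n}
    (h : ∀ v, (G.deleteEdges S).Reachable a v ∨ (G.deleteEdges S).Reachable b v) :
    n ≤ (G.incidenceCompl S).rank + 2 := by
  let L := (G.incidenceCompl S).mulVecLin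
  -- Kernel vectors are constant on components, so their values at `a` and `b` determine them: the
  -- nullity is at most 2.
  let ev : LinearMap.ker L →ₗ[ℝ] (Fin 2 → ℝ) :=
    (LinearMap.pi ![LinearMap.proj a, LinearMap.proj b]).comp (LinearMap.ker L).subtype
  have hinj : Function.Injective ev := by
    rw [← LinearMap.ker_eq_bot, LinearMap.ker_eq_bot']
    rintro ⟨f, hf⟩ h0
    have ha : f a = 0 := congrFun h0 0
    have hb : f b = 0 := congrFun h0 1
    have hS : ∀ i ∉ S, f (G.tgt i) = f (G.src i) := by
      intro i hi
      have h1 : (G.incidenceCompl S).mulVec f ⟨i, hi⟩ = 0 := congrFun (LinearMap.mem_ker.1 hf) ⟨i, hi⟩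
      have h2 : (G.incidenceCompl S).mulVec f ⟨i, hi⟩ = G.incidence.mulVec f i := rfl
      rw [h2, incidence_mulVec] at h1
      exact sub_eq_zero.1 h1
    ext v
    rcases h v with hv | hv
    · exact (G.eq_of_reachable hS hv).symm.trans ha
    · exact (G.eq_of_reachable hS hv).symm.trans hb
  have h1 := LinearMap.finrank_le_finrank_of_injective hinj
  have h2 := LinearMap.finrank_range_add_finrank_ker L
  have h3 : (G.incidenceCompl S).rank = Module.finrank ℝ (LinearMap.range L) := rfl
  simp only [Module.finrank_fin_fun] at h1 h2
  omega

/-- A connected set of vertices has a spanning tree, given by an injective family of edges. -/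
theorem exists_tree_edges (G : DirGraph n m) {W : Finset (Fin n)}
    (hW : ((G.deleteEdges ∅).induce (W : Set (Fin n))).Connected) :
    ∃ T : SimpleGraph (W : Set (Fin n)), T.IsTree ∧ ∃ A : Finset (Fin m),
      A.card + 1 = W.card ∧ (∀ i ∈ A, G.src i ∈ W ∧ G.tgt i ∈ W) ∧
      ∀ u v, T.Adj u v ↔ ∃ i ∈ A, s(G.src i, G.tgt i) = s(u.1, v.1) := by
  classical
  obtain ⟨T, hTle, hT⟩ := hW.exists_isTree_le
  -- Of several parallel edges only one index is chosen per tree edge.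
  have hex : ∀ e : T.edgeSet, ∃ i, s(G.src i, G.tgt i) = e.1.map Subtype.val := by
    rintro ⟨e, he⟩
    induction e using Sym2.ind with
    | h u v =>
      obtain ⟨i, -, h⟩ := hTle he
      exact ⟨i, by simpa [Sym2.eq_iff] using h⟩
  choose φ hφ using hex
  have hinj : Function.Injective φ := fun e e' h => Subtype.ext <|
    Sym2.map.injective Subtype.val_injective <| by rw [← hφ, ← hφ, h]
  refine ⟨T, hT, Finset.univ.image φ, ?_, ?_, ?_⟩
  · rw [Finset.card_image_of_injective _ hinj, Finset.card_univ, ← SimpleGraph.edgeFinset_card,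
      hT.card_edgeFinset]
    simp
  · intro i hi
    obtain ⟨e, -, rfl⟩ := Finset.mem_image.1 hi
    have h := hφ e
    obtain ⟨e, he⟩ := e
    induction e using Sym2.ind with
    | h u v =>
      have hu := u.2
      have hv := v.2
      simp only [Sym2.map_mk, Sym2.eq_iff] at h
      rcases h with ⟨h1, h2⟩ | ⟨h1, h2⟩
      · rw [h1, h2]; exact ⟨hu, hv⟩
      · rw [h1, h2]; exact ⟨hv, hu⟩
  · intro u v
    constructor
    · intro h
      exact ⟨φ ⟨s(u, v), h⟩, Finset.mem_image_of_mem _ (Finset.mem_univ _), hφ ⟨s(u, v), h⟩⟩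
    · rintro ⟨i, hi, h⟩
      obtain ⟨e, -, rfl⟩ := Finset.mem_image.1 hi
      rw [hφ] at h
      have h' : e.1 = s(u, v) := Sym2.map.injective Subtype.val_injective h
      exact (SimpleGraph.mem_edgeSet T).1 (h' ▸ e.2)

/-- Every partition into two connected sides comes from an admissible edge set. -/
theorem exists_isTwoTreeCut (G : DirGraph n m) {r : Fin n} {V₁ V₂ : Finset (Fin n)}
    (hinter : V₁ ∩ V₂ = ∅) (hunion : V₁ ∪ V₂ = Finset.univ) (hr : r ∈ V₁)
    (h₁ : ((G.deleteEdges ∅).induce (V₁ : Set (Fin n))).Connected)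
    (h₂ : ((G.deleteEdges ∅).induce (V₂ : Set (Fin n))).Connected) :
    ∃ S, G.IsTwoTreeCut r S V₁ V₂ := by
  classical
  have hnot : ∀ v, v ∈ V₁ → v ∉ V₂ := fun v hv hv' => by
    have := Finset.mem_inter.2 ⟨hv, hv'⟩
    simp [hinter] at this
  obtain ⟨T₁, hT₁, A₁, hA₁, hmem₁, hadj₁⟩ := G.exists_tree_edges h₁
  obtain ⟨T₂, hT₂, A₂, hA₂, hmem₂, hadj₂⟩ := G.exists_tree_edges h₂
  have hdisj : Disjoint A₁ A₂ := Finset.disjoint_left.2 fun i hi hi' =>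
    hnot _ (hmem₁ i hi).1 (hmem₂ i hi').1
  have hcardV : V₁.card + V₂.card = n := by
    rw [← Finset.card_union_of_disjoint (Finset.disjoint_iff_inter_eq_empty.2 hinter), hunion]
    simp
  have hcardA : (A₁ ∪ A₂).card + 2 = n := by
    rw [Finset.card_union_of_disjoint hdisj]
    omega
  have hcardS : (A₁ ∪ A₂)ᶜ.card + (A₁ ∪ A₂).card = m := by
    rw [Finset.card_compl_add_card]
    simp
  have hadjS : ∀ u v, (G.deleteEdges (A₁ ∪ A₂)ᶜ).Adj u v ↔
      ∃ i ∈ A₁ ∪ A₂, s(G.src i, G.tgt i) = s(u, v) := by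
    intro u v
    simp only [deleteEdges, Finset.mem_compl, not_not, Sym2.eq_iff]
  have hi₁ : (G.deleteEdges (A₁ ∪ A₂)ᶜ).induce (V₁ : Set (Fin n)) = T₁ := by
    ext u v
    rw [SimpleGraph.induce_adj, hadjS, hadj₁]
    constructor
    · rintro ⟨i, hi, h⟩
      rcases Finset.mem_union.1 hi with hi | hi
      · exact ⟨i, hi, h⟩
      · have hs : u.1 ∈ s(G.src i, G.tgt i) := h ▸ Sym2.mem_mk_left _ _
        rcases Sym2.mem_iff.1 hs with hs | hs
        · exact absurd (hs ▸ (hmem₂ i hi).1) (hnot _ u.2)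
        · exact absurd (hs ▸ (hmem₂ i hi).2) (hnot _ u.2)
    · rintro ⟨i, hi, h⟩
      exact ⟨i, Finset.mem_union_left _ hi, h⟩
  have hi₂ : (G.deleteEdges (A₁ ∪ A₂)ᶜ).induce (V₂ : Set (Fin n)) = T₂ := by
    ext u v
    rw [SimpleGraph.induce_adj, hadjS, hadj₂]
    constructor
    · rintro ⟨i, hi, h⟩
      rcases Finset.mem_union.1 hi with hi | hi
      · have hs : u.1 ∈ s(G.src i, G.tgt i) := h ▸ Sym2.mem_mk_left _ _
        rcases Sym2.mem_iff.1 hs with hs | hs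
        · exact absurd u.2 (hnot _ (hs ▸ (hmem₁ i hi).1))
        · exact absurd u.2 (hnot _ (hs ▸ (hmem₁ i hi).2))
      · exact ⟨i, hi, h⟩
    · rintro ⟨i, hi, h⟩
      exact ⟨i, Finset.mem_union_right _ hi, h⟩
  have ht₁ := hi₁ ▸ hT₁
  have ht₂ := hi₂ ▸ hT₂
  obtain ⟨b, hb⟩ := ht₂.connected.nonempty
  refine ⟨(A₁ ∪ A₂)ᶜ, ⟨by omega, ?_, hinter, hunion, hr, ?_, ht₁, ht₂⟩⟩
  -- Only `n - 2` rows remain, which bounds the rank above.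
  · apply le_antisymm
    · have h := (G.incidenceCompl (A₁ ∪ A₂)ᶜ).rank_le_card_height
      have hc : Fintype.card {i : Fin m // i ∉ (A₁ ∪ A₂)ᶜ} = (A₁ ∪ A₂).card := by
        simp only [Finset.mem_compl, not_not]
        exact Fintype.card_coe _
      omega
    · refine G.le_rank_incidenceCompl (a := r) (b := b) fun v => ?_
      have hv : v ∈ V₁ ∪ V₂ := hunion ▸ Finset.mem_univ v
      rcases Finset.mem_union.1 hv with hv | hv
      · exact Or.inl ((ht₁.connected.preconnected ⟨r, hr⟩ ⟨v, hv⟩).map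
          (SimpleGraph.Embedding.induce _).toHom)
      · exact Or.inr ((ht₂.connected.preconnected ⟨b, hb⟩ ⟨v, hv⟩).map
          (SimpleGraph.Embedding.induce _).toHom)
  · intro u hu v hv huv
    obtain ⟨i, hi, h⟩ := (hadjS u v).1 huv
    have hu' : u ∈ s(G.src i, G.tgt i) := h ▸ Sym2.mem_mk_left _ _
    have hv' : v ∈ s(G.src i, G.tgt i) := h ▸ Sym2.mem_mk_right _ _
    rcases Finset.mem_union.1 hi with hi | hi
    · rcases Sym2.mem_iff.1 hv' with rfl | rfl
      · exact hnot _ (hmem₁ i hi).1 hv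
      · exact hnot _ (hmem₁ i hi).2 hv
    · rcases Sym2.mem_iff.1 hu' with rfl | rfl
      · exact hnot _ hu (hmem₂ i hi).1
      · exact hnot _ hu (hmem₂ i hi).2

theorem incidence_mulVec_indicatorVec (G : DirGraph n m) (W : Finset (Fin n)) (i : Fin m) :
    (G.incidence.mulVec (indicatorVec W) i = 0 ∧ (G.tgt i ∈ W ↔ G.src i ∈ W)) ∨
    (G.incidence.mulVec (indicatorVec W) i = 1 ∧ G.tgt i ∈ W ∧ G.src i ∉ W) ∨
    (G.incidence.mulVec (indicatorVec W) i = -1 ∧ G.tgt i ∉ W ∧ G.src i ∈ W) := by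
  rw [incidence_mulVec]
  by_cases h1 : G.tgt i ∈ W <;> by_cases h2 : G.src i ∈ W <;> simp [indicatorVec, h1, h2]

/-- If `f` is not constant along the edges, then there is an admissible vertex set `W` across whose
boundary `f` is strictly monotone. -/
theorem exists_monotone_cut (G : DirGraph n m) (hG : G.Connected) (r : Fin n) {f : Fin n → ℝ}
    (hf : ∃ i, G.incidence.mulVec f i ≠ 0) :
    ∃ S V₁ W, G.IsTwoTreeCut r S V₁ W ∧ (∃ i, G.incidence.mulVec (indicatorVec W) i ≠ 0) ∧
      ∃ s : ℝ, ∀ i, G.incidence.mulVec (indicatorVec W) i ≠ 0 →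
        0 < s * G.incidence.mulVec (indicatorVec W) i * G.incidence.mulVec f i := by
  classical
  have hne : ∃ u v, f u ≠ f v := by
    obtain ⟨i, hi⟩ := hf
    rw [incidence_mulVec] at hi
    exact ⟨_, _, sub_ne_zero.1 hi⟩
  obtain ⟨K, hK, hK', hlt⟩ := SimpleGraph.Connected.exists_connected_cut_lt hG hne
  have hcross : ∀ W : Finset (Fin n), (∃ u, u ∈ W) → (∃ v, v ∉ W) →
      ∃ i, G.incidence.mulVec (indicatorVec W) i ≠ 0 := by
    rintro W ⟨u, hu⟩ ⟨v, hv⟩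
    by_contra! h
    have := G.eq_of_reachable (S := ∅) (f := indicatorVec W)
      (fun i _ => by have := h i; rw [incidence_mulVec] at this; exact sub_eq_zero.1 this)
      (hG.preconnected u v)
    simp [indicatorVec, hu, hv] at this
  obtain ⟨a, ha⟩ := hK.nonempty
  obtain ⟨b, hb⟩ := hK'.nonempty
  have hsrc : ∀ i, (G.deleteEdges ∅).Adj (G.src i) (G.tgt i) := fun i =>
    G.deleteEdges_adj_endpoints (Finset.notMem_empty i)
  have e1 : ((K.toFinset : Finset (Fin n)) : Set (Fin n)) = K := by simp
  have e2 : ((K.toFinsetᶜ : Finset (Fin n)) : Set (Fin n)) = Kᶜ := by simp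
  -- The atom lives on the side without the root. Since `f` is smaller on the `K` end of each cut
  -- edge, the sign `s` is `1` if that side is `Kᶜ` and `-1` if it is `K`.
  by_cases hr : r ∈ K
  · obtain ⟨S, hS⟩ := G.exists_isTwoTreeCut (r := r) (V₁ := K.toFinset) (V₂ := K.toFinsetᶜ)
      (Finset.inter_compl _) (Finset.union_compl _) (by simpa using hr) (by rw [e1]; exact hK)
      (by rw [e2]; exact hK')
    refine ⟨S, _, _, hS, hcross _ ⟨b, by simpa using hb⟩ ⟨a, by simpa using ha⟩, 1, fun i hi => ?_⟩
    rw [G.incidence_mulVec f]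
    rcases G.incidence_mulVec_indicatorVec K.toFinsetᶜ i with h | ⟨h, h1, h2⟩ | ⟨h, h1, h2⟩
    · exact absurd h.1 hi
    · simp only [Finset.mem_compl, Set.mem_toFinset, not_not] at h1 h2
      have := hlt _ h2 _ h1 (hsrc i)
      rw [h]; linarith
    · simp only [Finset.mem_compl, Set.mem_toFinset, not_not] at h1 h2
      have := hlt _ h1 _ h2 (hsrc i).symm
      rw [h]; linarith
  · obtain ⟨S, hS⟩ := G.exists_isTwoTreeCut (r := r) (V₁ := K.toFinsetᶜ) (V₂ := K.toFinset)
      (by rw [Finset.inter_comm, Finset.inter_compl]) (by rw [Finset.union_comm, Finset.union_compl])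
      (by simpa using hr) (by rw [e2]; exact hK') (by rw [e1]; exact hK)
    refine ⟨S, _, _, hS, hcross _ ⟨a, by simpa using ha⟩ ⟨b, by simpa using hb⟩, -1, fun i hi => ?_⟩
    rw [G.incidence_mulVec f]
    rcases G.incidence_mulVec_indicatorVec K.toFinset i with h | ⟨h, h1, h2⟩ | ⟨h, h1, h2⟩
    · exact absurd h.1 hi
    · simp only [Set.mem_toFinset] at h1 h2
      have := hlt _ h1 _ h2 (hsrc i).symm
      rw [h]; linarith
    · simp only [Set.mem_toFinset] at h1 h2
      have := hlt _ h2 _ h1 (hsrc i)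
      rw [h]; linarith

end DirGraph

/-! ### The `ℓ¹` norm -/

theorem l1norm_nonneg {ι : Type} [Fintype ι] (v : ι → ℝ) : 0 ≤ l1norm v :=
  Finset.sum_nonneg fun _ _ => abs_nonneg _

theorem l1norm_add_le {ι : Type} [Fintype ι] (v w : ι → ℝ) :
    l1norm (v + w) ≤ l1norm v + l1norm w := by
  unfold l1norm
  rw [← Finset.sum_add_distrib]
  exact Finset.sum_le_sum fun i _ => abs_add_le _ _

theorem l1norm_smul {ι : Type} [Fintype ι] (c : ℝ) (v : ι → ℝ) :
    l1norm (c • v) = |c| * l1norm v := by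
  simp [l1norm, abs_mul, Finset.mul_sum]

theorem l1norm_sum_le {ι κ : Type} [Fintype ι] (s : Finset κ) (v : κ → ι → ℝ) :
    l1norm (∑ j ∈ s, v j) ≤ ∑ j ∈ s, l1norm (v j) := by
  unfold l1norm
  rw [Finset.sum_comm]
  refine Finset.sum_le_sum fun i _ => ?_
  rw [Finset.sum_apply]
  exact Finset.abs_sum_le_sum_abs _ _

theorem onesCols_mulVec {n : ℕ} {ι : Type} [Fintype ι] (X : Matrix (Fin n) ι ℝ)
    (β : Unit ⊕ ι → ℝ) :
    (onesCols X).mulVec β = (fun _ => β (Sum.inl ())) + ∑ j, β (Sum.inr j) • X.col j := by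
  ext i
  simp [onesCols, Matrix.mulVec, dotProduct, Fintype.sum_sum_type, mul_comm]

/-! ### Decomposition into atoms -/

namespace DirGraph

variable {n m : ℕ}

/-- Not an equality: if `D` kills the indicator, division by zero makes the atom zero. Thus `W`
needs no side condition. -/
theorem l1norm_incidence_atom_le (G : DirGraph n m) (W : Finset (Fin n)) :
    l1norm (G.incidence.mulVec (G.atom W)) ≤ 1 := by
  set c := l1norm (G.incidence.mulVec (indicatorVec W)) with hc
  have h : G.atom W = c⁻¹ • indicatorVec W := by
    ext i
    simp [atom, hc, div_eq_inv_mul]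
  rw [h, Matrix.mulVec_smul, l1norm_smul, abs_inv, ← hc, abs_of_nonneg (hc ▸ l1norm_nonneg _)]
  exact inv_mul_le_one

/-- The intercept costs nothing because `D` kills constants. An arbitrary family `side` covers both
dictionaries. -/
theorem l1norm_incidence_onesCols_le (G : DirGraph n m) {ι : Type} [Fintype ι]
    (side : ι → Finset (Fin n)) (β : Unit ⊕ ι → ℝ) :
    l1norm (G.incidence.mulVec
        ((onesCols (Matrix.of fun i j => G.atom (side j) i)).mulVec β)) ≤
      l1norm fun j => β (Sum.inr j) := by
  have h1 : G.incidence.mulVec (fun _ => β (Sum.inl ())) = 0 := by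
    ext i
    simp [incidence_mulVec]
  rw [onesCols_mulVec, Matrix.mulVec_add, h1, zero_add, Matrix.mulVec_sum]
  refine (l1norm_sum_le _ _).trans (Finset.sum_le_sum fun j _ => ?_)
  rw [Matrix.mulVec_smul, l1norm_smul]
  exact mul_le_of_le_one_right (abs_nonneg _) (G.l1norm_incidence_atom_le (side j))

/-- Every vector is a combination of the constant vector and the atoms, in which the coefficients of
the atoms have `ℓ¹` norm at most `‖D f‖₁`. -/
theorem exists_coefficients (G : DirGraph n m) (hG : G.Connected) (r : Fin n) {ι : Type} [Fintype ι]
    (side : ι → Finset (Fin n))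
    (hside : ∀ S V₁ V₂, G.IsTwoTreeCut r S V₁ V₂ → ∃ j, side j = V₂) (f : Fin n → ℝ) :
    ∃ β, (onesCols (Matrix.of fun i j => G.atom (side j) i)).mulVec β = f ∧
      (l1norm fun j => β (Sum.inr j)) ≤ l1norm (G.incidence.mulVec f) := by
  classical
  -- Induction on the number of edges along which `f` jumps.
  induction hk : (Finset.univ.filter fun i => G.incidence.mulVec f i ≠ 0).card
    using Nat.strong_induction_on generalizing f with
  | _ k ih =>
  by_cases hf : ∃ i, G.incidence.mulVec f i ≠ 0
  · obtain ⟨S, V₁, W, hcut, ⟨i₀, hi₀⟩, s, hs⟩ := G.exists_monotone_cut hG r hf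
    obtain ⟨j, hj⟩ := hside _ _ _ hcut
    set d := G.incidence.mulVec (indicatorVec W) with hd
    set g := G.incidence.mulVec f with hg
    have hd1 : ∀ i, d i ≠ 0 → |d i| = 1 := by
      intro i hi
      rcases G.incidence_mulVec_indicatorVec W i with h | h | h
      · exact absurd h.1 hi
      · rw [hd, h.1]; simp
      · rw [hd, h.1]; simp
    obtain ⟨i₁, hi₁, hmin⟩ := (Finset.univ.filter fun i => d i ≠ 0).exists_min_image (fun i => |g i|)
      ⟨i₀, by simpa using hi₀⟩
    replace hi₁ : d i₁ ≠ 0 := by simpa using hi₁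
    replace hmin : ∀ i, d i ≠ 0 → |g i₁| ≤ |g i| := fun i hi => hmin i (by simpa using hi)
    -- the common sign of `d i * g i`, times the smallest jump
    let t : ℝ := d i₁ * g i₁
    have hdsq : ∀ i, d i ≠ 0 → d i * d i = 1 := fun i hi => by
      rw [← abs_mul_abs_self, hd1 i hi, one_mul]
    -- On the cut, `d i * g i` has the sign of `t` and absolute value at least `|t|`, so there is no
    -- overshoot.
    have habs : ∀ i, |g i - t * d i| = |g i| - |t| * |d i| := by
      intro i
      by_cases hi : d i = 0
      · simp [hi]
      · have h1 := hs i hi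
        have h2 := hs i₁ hi₁
        have h3 : |t| = |g i₁| := by simp [t, abs_mul, hd1 i₁ hi₁]
        have h4 : 0 < (d i * g i) * t := by
          have := mul_pos h1 h2
          have h5 : s * d i * g i * (s * d i₁ * g i₁) = s ^ 2 * ((d i * g i) * t) := by
            simp only [t]; ring
          rw [h5] at this
          exact pos_of_mul_pos_right this (sq_nonneg s)
        have h5 : |g i - t * d i| = |d i * g i - t| := by
          rw [← one_mul |g i - t * d i|, ← hd1 i hi, ← abs_mul]
          congr 1
          linear_combination (-t) * hdsq i hi
        have h6 : |d i * g i| = |g i| := by rw [abs_mul, hd1 i hi, one_mul]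
        have h7 := hmin i hi
        rw [← h3, ← h6] at h7
        rw [h5, hd1 i hi, mul_one, ← h6]
        rcases pos_and_pos_or_neg_and_neg_of_mul_pos h4 with ⟨p, q⟩ | ⟨p, q⟩
        · rw [abs_of_pos p, abs_of_pos q] at *
          rw [abs_of_nonneg (by linarith)]
        · rw [abs_of_neg p, abs_of_neg q] at *
          rw [abs_of_nonpos (by linarith)]
          ring
    have hg' : G.incidence.mulVec (f - t • indicatorVec W) = g - t • d := by
      rw [Matrix.mulVec_sub, Matrix.mulVec_smul]
    -- Edge `i₁` becomes flat; edges already flat are not in the cut and stay flat.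
    have hlt : (Finset.univ.filter fun i =>
        G.incidence.mulVec (f - t • indicatorVec W) i ≠ 0).card < k := by
      rw [← hk, hg']
      apply Finset.card_lt_card
      rw [Finset.ssubset_iff_of_subset]
      · refine ⟨i₁, ?_, ?_⟩
        · simp only [Finset.mem_filter, Finset.mem_univ, true_and]
          intro h
          have := hs i₁ hi₁
          simp [h] at this
        · simp only [Finset.mem_filter, Finset.mem_univ, true_and, not_not, Pi.sub_apply,
            Pi.smul_apply, smul_eq_mul, t]
          linear_combination (-g i₁) * hdsq i₁ hi₁
      · intro i
        simp only [Finset.mem_filter, Finset.mem_univ, true_and, Pi.sub_apply, Pi.smul_apply,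
          smul_eq_mul]
        intro h h0
        apply h
        rw [h0]
        have := hs i
        simp only [h0, mul_zero, lt_self_iff_false, imp_false, not_not] at this
        simp [this]
    obtain ⟨β, hβ, hβn⟩ := ih _ hlt (f - t • indicatorVec W) rfl
    have hnorm : l1norm (g - t • d) = l1norm g - |t| * l1norm d := by
      simp only [l1norm, Pi.sub_apply, Pi.smul_apply, smul_eq_mul, habs, Finset.sum_sub_distrib,
        Finset.mul_sum]
    have hdpos : 0 < l1norm d :=
      Finset.sum_pos' (fun _ _ => abs_nonneg _) ⟨i₀, Finset.mem_univ _, abs_pos.2 hi₀⟩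
    -- The factor `l1norm d` undoes the normalization of the atom.
    refine ⟨β + Pi.single (Sum.inr j) (t * l1norm d), ?_, ?_⟩
    · rw [Matrix.mulVec_add, hβ, Matrix.mulVec_single]
      ext i
      simp only [Pi.add_apply, Pi.sub_apply, Pi.smul_apply, smul_eq_mul, onesCols,
        Matrix.fromCols_apply_inr, Matrix.of_apply, hj, atom, ← hd, Matrix.col_apply,
        MulOpposite.smul_eq_mul_unop, MulOpposite.unop_op]
      field_simp
      ring
    · have hsplit : (fun l => (β + Pi.single (Sum.inr j) (t * l1norm d) : Unit ⊕ ι → ℝ) (Sum.inr l)) =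
          (fun l => β (Sum.inr l)) + Pi.single j (t * l1norm d) := by
        ext l
        simp [Pi.single_apply]
      have hsingle : l1norm (Pi.single j (t * l1norm d) : ι → ℝ) = |t| * l1norm d := by
        rw [l1norm, Finset.sum_eq_single j]
        · simp [abs_mul, abs_of_pos hdpos]
        · intro l _ hl; simp [hl]
        · simp
      rw [hsplit]
      refine (l1norm_add_le _ _).trans ?_
      rw [hg', hnorm] at hβn
      rw [hsingle]
      linarith
  · push Not at hf
    refine ⟨Sum.elim (fun _ => f r) 0, ?_, ?_⟩
    · rw [onesCols_mulVec]
      ext v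
      have := G.eq_of_reachable (S := ∅) (f := f)
        (fun i _ => by have := hf i; rw [incidence_mulVec] at this; exact sub_eq_zero.1 this)
        (hG.preconnected r v)
      simpa using this
    · simpa [l1norm] using Finset.sum_nonneg fun i _ => abs_nonneg (G.incidence.mulVec f i)

end DirGraph

/-! ### Uniqueness for the analysis problem and transfer to the lasso -/

/-- The analysis problem has exactly one solution. -/
theorem exists_analysisArgmin_eq_singleton {n m : ℕ} (hn : 0 < n) (D : Matrix (Fin m) (Fin n) ℝ)
    (Y : Fin n → ℝ) {lam : ℝ} (hlam : 0 ≤ lam) : ∃ fA, analysisArgmin D Y lam = {fA} := by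
  have hn' : (0 : ℝ) < n := Nat.cast_pos.2 hn
  set F : (Fin n → ℝ) → ℝ := fun f => sqNorm (Y - f) + 2 * lam * l1norm (D.mulVec f) with hF
  have hcont : Continuous F := by
    simp only [hF, sqNorm, l1norm, Matrix.mulVec, dotProduct, Pi.sub_apply]
    fun_prop
  have hbdd : Bornology.IsBounded {f | F f ≤ F 0} := by
    -- The radius comes from `|u| ≤ u ^ 2 + 1`.
    refine (Metric.isBounded_Icc (Y - fun _ => n * F 0 + 1) (Y + fun _ => n * F 0 + 1)).subset ?_
    intro f hf
    have h1 : ∀ i, (Y i - f i) ^ 2 ≤ n * F 0 := by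
      intro i
      have h2 : sqNorm (Y - f) ≤ F 0 :=
        (le_add_of_nonneg_right (mul_nonneg (by positivity) (l1norm_nonneg _))).trans hf
      rw [sqNorm, div_le_iff₀ hn', mul_comm] at h2
      exact (Finset.single_le_sum (f := fun i => (Y - f) i ^ 2) (fun _ _ => sq_nonneg _)
        (Finset.mem_univ i)).trans h2
    constructor
    · intro i
      have := h1 i
      simp only [Pi.sub_apply]
      nlinarith [sq_nonneg (Y i - f i - 1), sq_nonneg (Y i - f i)]
    · intro i
      have := h1 i
      simp only [Pi.add_apply]
      nlinarith [sq_nonneg (Y i - f i + 1), sq_nonneg (Y i - f i)]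
  obtain ⟨fA, hfA⟩ := hcont.exists_forall_le_of_isBounded 0 hbdd
  refine ⟨fA, Set.eq_singleton_iff_unique_mem.2 ⟨hfA, fun g hg => ?_⟩⟩
  -- Strict convexity: at the midpoint of two minimizers the quadratic term gains `sqNorm (g - fA) /
  -- 4`.
  set c := (2⁻¹ : ℝ) • (fA + g) with hc
  have h1 : sqNorm (Y - c) = (sqNorm (Y - fA) + sqNorm (Y - g)) / 2 - sqNorm (g - fA) / 4 := by
    simp only [sqNorm, Pi.sub_apply]
    have key : ∑ i, (Y i - c i) ^ 2 =
        (∑ i, (Y i - fA i) ^ 2 + ∑ i, (Y i - g i) ^ 2) / 2 - (∑ i, (g i - fA i) ^ 2) / 4 := by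
      rw [← Finset.sum_add_distrib, Finset.sum_div, Finset.sum_div, ← Finset.sum_sub_distrib]
      refine Finset.sum_congr rfl fun i _ => ?_
      simp only [hc, Pi.smul_apply, Pi.add_apply, smul_eq_mul]
      ring
    rw [key]
    ring
  have h2 : l1norm (D.mulVec c) ≤ (l1norm (D.mulVec fA) + l1norm (D.mulVec g)) / 2 := by
    rw [hc, Matrix.mulVec_smul, l1norm_smul, Matrix.mulVec_add, abs_of_pos (by norm_num)]
    linarith [l1norm_add_le (D.mulVec fA) (D.mulVec g)]
  have h3 : F fA ≤ F c := hfA c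
  have h4 : F g ≤ F c := hg c
  have h5 := mul_le_mul_of_nonneg_left h2 (mul_nonneg zero_le_two hlam)
  have h6 : sqNorm (g - fA) ≤ 0 := by
    simp only [hF] at h3 h4
    linarith
  rw [sqNorm, div_le_iff₀ hn', zero_mul] at h6
  have h7 := (Finset.sum_eq_zero_iff_of_nonneg fun i _ => sq_nonneg ((g - fA) i)).1
    (le_antisymm h6 (Finset.sum_nonneg fun i _ => sq_nonneg _))
  ext i
  have := h7 i (Finset.mem_univ i)
  exact sub_eq_zero.1 (pow_eq_zero_iff two_ne_zero |>.1 this)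

/-- If `‖D f‖₁` is the smallest `ℓ¹` norm of the penalized coefficients of a representation of `f`,
then the analysis problem and the lasso have the same fits. -/
theorem image_lassoArgmin_eq_analysisArgmin {n m : ℕ} {ι : Type} [Fintype ι]
    {D : Matrix (Fin m) (Fin n) ℝ} {X : Matrix (Fin n) ι ℝ} (Y : Fin n → ℝ) {lam : ℝ}
    (hlam : 0 ≤ lam)
    (hle : ∀ β, l1norm (D.mulVec ((onesCols X).mulVec β)) ≤ l1norm fun j => β (Sum.inr j))
    (hex : ∀ f, ∃ β, (onesCols X).mulVec β = f ∧
      (l1norm fun j => β (Sum.inr j)) ≤ l1norm (D.mulVec f)) :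
    (onesCols X).mulVec '' lassoArgmin X Y lam = analysisArgmin D Y lam := by
  have h2 : 0 ≤ 2 * lam := by positivity
  ext f
  constructor
  · rintro ⟨β, hβ, rfl⟩ g
    obtain ⟨γ, rfl, hγ⟩ := hex g
    have h3 := hβ γ
    have h4 := mul_le_mul_of_nonneg_left hγ h2
    have h5 := mul_le_mul_of_nonneg_left (hle β) h2
    dsimp only at h3 ⊢
    linarith
  · intro hf
    -- Cheapest coefficients of an analysis solution solve the lasso, which also gives existence
    -- there.
    obtain ⟨β, rfl, hβ⟩ := hex f
    refine ⟨β, fun γ => ?_, rfl⟩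
    have h3 := hf ((onesCols X).mulVec γ)
    have h4 := mul_le_mul_of_nonneg_left hβ h2
    have h5 := mul_le_mul_of_nonneg_left (hle γ) h2
    dsimp only at h3 ⊢
    linarith

/-- An image equal to `{fA}` says both that the lasso has a solution and that every solution has fit
`fA`. -/
theorem mainTheorem2 (n m : ℕ) (G : DirGraph n m) (hG : G.Connected) (r : Fin n)
    (Y : Fin n → ℝ) (lam : ℝ) (hlam : 0 < lam) :
    ∃ fA : Fin n → ℝ,
      analysisArgmin G.incidence Y lam = {fA} ∧
      (onesCols (G.cutDictionary r)).mulVec '' lassoArgmin (G.cutDictionary r) Y lam = {fA} ∧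
      (onesCols (G.sideDictionary r)).mulVec '' lassoArgmin (G.sideDictionary r) Y lam = {fA} := by
  obtain ⟨fA, hfA⟩ := exists_analysisArgmin_eq_singleton r.pos G.incidence Y hlam.le
  refine ⟨fA, hfA, ?_, ?_⟩
  · rw [← hfA]
    exact image_lassoArgmin_eq_analysisArgmin Y hlam.le
      (G.l1norm_incidence_onesCols_le fun S : G.CutIndex r => G.farSide r S.1)
      (G.exists_coefficients hG r _ fun S V₁ V₂ h => ⟨⟨S, V₁, V₂, h⟩, h.eq_farSide.symm⟩)
  · rw [← hfA]
    exact image_lassoArgmin_eq_analysisArgmin Y hlam.le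
      (G.l1norm_incidence_onesCols_le fun W : G.SideIndex r => W.1)
      (G.exists_coefficients hG r _ fun S V₁ V₂ h => ⟨⟨V₂, S, V₁, h⟩, rfl⟩)
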